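/- **Theorem.** For every dimension $d\in\mathbb{N}$, every density $\kappa\in\mathbb{R}$ and every real $S>0$ there is a positive constant $K=K(d,\kappa,S)$ such that the following holds: if $X_1,X_2\subseteq\mathbb{R}^d$ are periodic point sets of density $\kappa$, each of which has representatives $X_i=\Lambda_i+P_i$ with $\operatorname{diam}(U(\Lambda_i))\le S$ ($i=1,2$), then $d_{EB}(X_1,X_2)\le K$. Here $\mathbb{R}^d$ carries the Euclidean norm. A *lattice* $\Lambda$ is the set of all integer combinations of a basis $v_1,\dots,v_d$ of $\mathbb{R}^d$ (its *generators*), and its *unit cell* with respect to these generators is $U(\Lambda)=\{\sum_{i=1}^d t_iv_i : t_i\in[0,1)\}$. A *periodic point set* is a set $X=\Lambda+P=\{\lambda+x:\lambda\in\Lambda,\ x\in P\}$, where $\Lambda$ is a lattice with chosen generators and $P$ is a finite subset of $U(\Lambda)$; any such pair $(\Lambda,P)$ is called *representatives* of $X$. The *density* of $X$ is $|P|/\operatorname{Vol}(U(\Lambda))$, which does not depend on the choice of representatives. For $X,Y\subseteq\mathbb{R}^d$ put $$d_B(X,Y)=\inf_{f\colon X\to Y\text{ bijection}}\ \sup_{x\in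 X}\lVert x-f(x)\rVert\in[0,\infty],\qquad d_{EB}(X,Y)=\inf_{\psi\in\mathrm{Iso}(\mathbb{R}^d)} d_B(X,\psi(Y)),$$ where $\mathrm{Iso}(\mathbb{R}^d)$ is the group of all isometries of $\mathbb{R}^d$ and $d_B(X,Y)=\infty$ if there is no bijection $X\to Y$; $d_{EB}$ is the *Euclidean bottleneck distance*. -/

import Mathlib

open scoped Pointwise ENNReal

namespace PeriodicPointSet

/-- Euclidean space `ℝ^d` with its usual norm. -/
abbrev Space (d : ℕ) : Type := EuclideanSpace ℝ (Fin d)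

/-- The lattice generated by a basis `v` of `ℝ^d`: all integer combinations of the generators. -/
def lattice {d : ℕ} (v : Module.Basis (Fin d) ℝ (Space d)) : Submodule ℤ (Space d) :=
  Submodule.span ℤ (Set.range v)

/-- The half-open unit cell `{∑ tᵢ vᵢ | tᵢ ∈ [0, 1)}` of the lattice with generators `v`. -/
def unitCell {d : ℕ} (v : Module.Basis (Fin d) ℝ (Space d)) : Set (Space d) :=
  {x | ∃ t : Fin d → ℝ, (∀ i, t i ∈ Set.Ico (0 : ℝ) 1) ∧ x = ∑ i, t i • v i}

/-- The lattice with generators `v` and the motif `P` are representatives of `X`: the motif is a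
finite subset of the unit cell, and `X` is the Minkowski sum of the lattice and the motif. -/
structure IsRepresentative {d : ℕ} (X : Set (Space d))
    (v : Module.Basis (Fin d) ℝ (Space d)) (P : Finset (Space d)) : Prop where
  motif_subset : (P : Set (Space d)) ⊆ unitCell v
  eq_add : X = (lattice v : Set (Space d)) + (P : Set (Space d))

/-- The density `|P| / Vol(U)` computed from representatives. -/
noncomputable def repDensity {d : ℕ} (v : Module.Basis (Fin d) ℝ (Space d))
    (P : Finset (Space d)) : ℝ :=
  (P.card : ℝ) / MeasureTheory.volume.real (unitCell v)

/-- The periodic point sets of `ℝ^d` of density `κ`. The density is computed from some choice of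
representatives, which need not be the choice used elsewhere for the same set. -/
def PPSOfDensity (d : ℕ) (κ : ℝ) : Set (Set (Space d)) :=
  {X | ∃ v P, IsRepresentative X v P ∧ repDensity v P = κ}

/-- The bottleneck distance, with values in `[0, ∞]`; it is `∞` if there is no bijection. -/
noncomputable def bottleneckDist {d : ℕ} (X Y : Set (Space d)) : ℝ≥0∞ :=
  ⨅ f : X ≃ Y, ⨆ x : X, edist (x : Space d) (f x : Space d)

/-- The Euclidean bottleneck distance: the infimum of the bottleneck distances from `X` to `ψ(Y)`,
over all isometries `ψ` of `ℝ^d`. -/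
noncomputable def euclideanBottleneckDist {d : ℕ} (X Y : Set (Space d)) : ℝ≥0∞ :=
  ⨅ ψ : Space d ≃ᵢ Space d, bottleneckDist X (ψ '' Y)

/-- The unit cell is Mathlib's fundamental domain of the basis. -/
theorem unitCell_eq {d : ℕ} (v : Module.Basis (Fin d) ℝ (Space d)) :
    unitCell v = ZSpan.fundamentalDomain v := by
  ext x
  constructor
  · rintro ⟨t, ht, rfl⟩ i
    rw [v.repr_sum_self]
    exact ht i
  · intro h
    exact ⟨fun i => v.repr x i, h, (v.sum_repr x).symm⟩

/-- Unit cells are bounded, so that their real-valued diameter is meaningful. -/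
theorem isBounded_unitCell {d : ℕ} (v : Module.Basis (Fin d) ℝ (Space d)) :
    Bornology.IsBounded (unitCell v) := by
  rw [unitCell_eq]
  exact ZSpan.fundamentalDomain_isBounded v

end PeriodicPointSet

/-!
The constant `2 * S` works, independently of the dimension and of the density, and with the
identity as the isometry.

Let `X` be a periodic point set of density `κ` whose unit cell `U` has diameter at most `S`. The
translates of `U` by lattice vectors tile the space, each of them contains exactly `|P|` points of
`X`, and `|P| = κ * vol U`. Counting tiles therefore compares numbers of points with volumes:

* a finite set of points of `X` has at most `κ * vol F` elements, if `F` contains the `S`-balls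
  around them, as every tile that meets the set lies in `F`
  (`IsRepresentative.card_mul_volume_le`);
* within distance `S` of a bounded set `E` there are at least `κ * vol E` points of `X`, as the
  tiles that meet `E` cover `E` (`IsRepresentative.card_mul_volume_ge`).

If `X` and `Y` are two such sets of the same density and `A ⊆ X` is finite, apply these estimates
with `E = F` the union of the `S`-balls around the points of `A`: at least `|A|` points of `Y` lie
within `2 * S` of `A`. This is Hall's condition, so there is an injection `X → Y` that moves no
point by more than `2 * S` (`exists_injective_dist_le`). By symmetry there is one from `Y` to `X`,
and the Schröder–Bernstein argument merges the two into a bijection with the same bound.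

The densities in the hypotheses may be computed from representatives other than those with small
cells. The two estimates, applied to large balls, also show that the density does not depend on the
representatives (`IsRepresentative.repDensity_eq`).
-/

namespace PeriodicPointSet

open MeasureTheory Metric

variable {d : ℕ}

/-! ### The tiling by translates of the unit cell -/

/-- The integer part of `x` is the unique lattice vector `l` such that the tile `l + U`
contains `x`. -/
theorem sub_mem_unitCell_iff (v : Module.Basis (Fin d) ℝ (Space d)) {l : Space d}
    (hl : l ∈ lattice v) (x : Space d) :
    x - l ∈ unitCell v ↔ (ZSpan.floor v x : Space d) = l := by
  have h := ZSpan.vadd_mem_fundamentalDomain v (-(⟨l, hl⟩ : Submodule.span ℤ (Set.range v))) x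
  rw [neg_inj, Subtype.ext_iff, Submodule.vadd_def, vadd_eq_add] at h
  rw [unitCell_eq, eq_comm, ← h, sub_eq_neg_add]
  rfl

theorem floor_add_eq (v : Module.Basis (Fin d) ℝ (Space d)) {l p : Space d}
    (hl : l ∈ lattice v) (hp : p ∈ unitCell v) : (ZSpan.floor v (l + p) : Space d) = l := by
  rw [← sub_mem_unitCell_iff v hl]
  simpa using hp

theorem fract_add_eq (v : Module.Basis (Fin d) ℝ (Space d)) {l p : Space d}
    (hl : l ∈ lattice v) (hp : p ∈ unitCell v) : ZSpan.fract v (l + p) = p := by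
  rw [ZSpan.fract_apply, floor_add_eq v hl hp, add_sub_cancel_left]

theorem dist_le_diam_of_floor_eq (v : Module.Basis (Fin d) ℝ (Space d)) {x y : Space d}
    (h : (ZSpan.floor v x : Space d) = ZSpan.floor v y) : dist x y ≤ diam (unitCell v) := by
  have hd : dist x y = dist (ZSpan.fract v x) (ZSpan.fract v y) := by
    rw [ZSpan.fract_apply, ZSpan.fract_apply, h, dist_sub_right]
  rw [hd]
  refine dist_le_diam_of_mem (isBounded_unitCell v) ?_ ?_ <;>
  · rw [unitCell_eq]
    exact ZSpan.fract_mem_fundamentalDomain v _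

theorem measurableSet_unitCell (v : Module.Basis (Fin d) ℝ (Space d)) :
    MeasurableSet (unitCell v) := by
  rw [unitCell_eq]
  exact ZSpan.fundamentalDomain_measurableSet v

theorem setOf_floor_eq (v : Module.Basis (Fin d) ℝ (Space d)) {l : Space d}
    (hl : l ∈ lattice v) :
    {x | (ZSpan.floor v x : Space d) = l} = (fun x => x - l) ⁻¹' unitCell v := by
  ext x
  exact (sub_mem_unitCell_iff v hl x).symm

theorem measurableSet_floor_eq (v : Module.Basis (Fin d) ℝ (Space d)) {l : Space d}
    (hl : l ∈ lattice v) : MeasurableSet {x | (ZSpan.floor v x : Space d) = l} := by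
  rw [setOf_floor_eq v hl]
  exact (measurable_sub_const l) (measurableSet_unitCell v)

theorem volume_floor_eq (v : Module.Basis (Fin d) ℝ (Space d)) {l : Space d}
    (hl : l ∈ lattice v) :
    volume {x | (ZSpan.floor v x : Space d) = l} = volume (unitCell v) := by
  rw [setOf_floor_eq v hl]
  simp only [sub_eq_add_neg]
  exact measure_preimage_add_right volume _ _

theorem volume_real_unitCell_pos (v : Module.Basis (Fin d) ℝ (Space d)) :
    0 < volume.real (unitCell v) := by
  refine ENNReal.toReal_pos ?_ (isBounded_unitCell v).measure_lt_top.ne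
  rw [unitCell_eq]
  exact ZSpan.measure_fundamentalDomain_ne_zero v

/-- Only finitely many tiles meet a bounded set. -/
theorem finite_image_floor (v : Module.Basis (Fin d) ℝ (Space d)) {E : Set (Space d)}
    (hE : Bornology.IsBounded E) :
    ((fun x => (ZSpan.floor v x : Space d)) '' E).Finite := by
  refine (ZSpan.setFinite_inter v (hE.cthickening (δ := ∑ i, ‖v i‖))).subset ?_
  rintro _ ⟨x, hx, rfl⟩
  refine ⟨mem_cthickening_of_dist_le _ x _ _ hx ?_, (ZSpan.floor v x).2⟩
  rw [dist_comm, dist_eq_norm]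
  exact ZSpan.norm_fract_le v x

/-! ### Counting points of a periodic point set -/

section Counting

variable {X : Set (Space d)} {v : Module.Basis (Fin d) ℝ (Space d)} {P : Finset (Space d)}

theorem IsRepresentative.add_mem (h : IsRepresentative X v P) {l p : Space d}
    (hl : l ∈ lattice v) (hp : p ∈ P) : l + p ∈ X := by
  rw [h.eq_add]
  exact Set.add_mem_add hl hp

theorem IsRepresentative.fract_mem (h : IsRepresentative X v P) {x : Space d} (hx : x ∈ X) :
    ZSpan.fract v x ∈ P := by
  rw [h.eq_add] at hx
  obtain ⟨l, hl, p, hp, rfl⟩ := hx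
  change ZSpan.fract v (l + p) ∈ P
  rw [fract_add_eq v hl (h.motif_subset hp)]
  exact hp

/-- A periodic point set is locally finite. -/
theorem IsRepresentative.finite_inter (h : IsRepresentative X v P) {E : Set (Space d)}
    (hE : Bornology.IsBounded E) : (X ∩ E).Finite := by
  refine ((finite_image_floor v hE).add P.finite_toSet).subset ?_
  rintro x ⟨hx, hxE⟩
  exact ⟨_, ⟨x, hxE, rfl⟩, _, h.fract_mem hx, add_sub_cancel _ _⟩

/-- A finite set `A` of points of `X` has at most `|P|` elements in each tile, and the tiles that
meet `A` are disjoint subsets of any set containing the balls around the points of `A` whose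
radius is the diameter of the unit cell. -/
theorem IsRepresentative.card_mul_volume_le (h : IsRepresentative X v P) {S : ℝ}
    (hS : diam (unitCell v) ≤ S) {A : Finset (Space d)} (hA : ∀ a ∈ A, a ∈ X)
    {F : Set (Space d)} (hF : volume F ≠ ⊤) (hAF : ∀ a ∈ A, closedBall a S ⊆ F) :
    A.card * volume.real (unitCell v) ≤ P.card * volume.real F := by
  classical
  set T : Finset (Space d) := A.image fun x => (ZSpan.floor v x : Space d)
  have hTL : ∀ l ∈ T, l ∈ lattice v := by
    intro l hl
    obtain ⟨a, -, rfl⟩ := Finset.mem_image.1 hl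
    exact (ZSpan.floor v a).2
  have hcard : A.card ≤ P.card * T.card := by
    refine Finset.card_le_mul_card_image A _ fun l _ => ?_
    refine Finset.card_le_card_of_injOn (ZSpan.fract v)
      (fun a ha => h.fract_mem (hA a (Finset.mem_filter.1 ha).1)) ?_
    intro a ha b hb hab
    have hfl := (Finset.mem_filter.1 ha).2.trans (Finset.mem_filter.1 hb).2.symm
    rw [ZSpan.fract_apply, ZSpan.fract_apply, hfl] at hab
    exact sub_left_injective hab
  have hvol : T.card * volume.real (unitCell v) ≤ volume.real F := by
    have hU : volume (⋃ l ∈ T, {x | (ZSpan.floor v x : Space d) = l})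
        = T.card * volume (unitCell v) := by
      rw [measure_biUnion_finset ?_ fun l hl => measurableSet_floor_eq v (hTL l hl),
        Finset.sum_congr rfl fun l hl => volume_floor_eq v (hTL l hl), Finset.sum_const,
        nsmul_eq_mul]
      intro l _ m _ hlm
      refine Set.disjoint_left.2 fun x hx hx' => hlm ?_
      exact Eq.trans (Eq.symm hx) hx'
    have hsub : (⋃ l ∈ T, {x | (ZSpan.floor v x : Space d) = l}) ⊆ F := by
      refine Set.iUnion₂_subset fun l hl x hx => ?_
      obtain ⟨a, ha, rfl⟩ := Finset.mem_image.1 hl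
      exact hAF a ha (mem_closedBall.2 ((dist_le_diam_of_floor_eq v hx).trans hS))
    have hle := ENNReal.toReal_mono hF (measure_mono hsub)
    rw [hU, ENNReal.toReal_mul, ENNReal.toReal_natCast] at hle
    exact hle
  calc (A.card : ℝ) * volume.real (unitCell v)
      ≤ (P.card * T.card : ℕ) * volume.real (unitCell v) := by gcongr
    _ = P.card * (T.card * volume.real (unitCell v)) := by push_cast; ring
    _ ≤ P.card * volume.real F := by gcongr

/-- The tiles that meet a bounded set `E` cover `E`, and each of them contains `|P|` points of `X`,
whose distance to `E` is at most the diameter of the unit cell. -/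
theorem IsRepresentative.card_mul_volume_ge (h : IsRepresentative X v P) {S : ℝ}
    (hS : diam (unitCell v) ≤ S) {E : Set (Space d)} (hE : Bornology.IsBounded E)
    {B : Finset (Space d)} (hB : ∀ x ∈ X, ∀ e ∈ E, dist x e ≤ S → x ∈ B) :
    P.card * volume.real E ≤ B.card * volume.real (unitCell v) := by
  classical
  set T : Finset (Space d) := (finite_image_floor v hE).toFinset
  have hmem : ∀ l ∈ T, ∃ e ∈ E, (ZSpan.floor v e : Space d) = l := fun l hl =>
    (finite_image_floor v hE).mem_toFinset.1 hl
  have hTL : ∀ l ∈ T, l ∈ lattice v := by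
    intro l hl
    obtain ⟨e, -, rfl⟩ := hmem l hl
    exact (ZSpan.floor v e).2
  have hcard : T.card * P.card ≤ B.card := by
    rw [← Finset.card_product]
    refine Finset.card_le_card_of_injOn (fun q => q.1 + q.2) ?_ ?_
    · rintro ⟨l, p⟩ hq
      obtain ⟨hl, hp⟩ := Finset.mem_product.1 hq
      obtain ⟨e, he, hel⟩ := hmem l hl
      refine hB _ (h.add_mem (hTL l hl) hp) e he ((dist_le_diam_of_floor_eq v ?_).trans hS)
      rw [hel]
      exact floor_add_eq v (hTL l hl) (h.motif_subset hp)
    · rintro ⟨l, p⟩ hq ⟨m, q⟩ hq' heq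
      obtain ⟨hl, hp⟩ := Finset.mem_product.1 hq
      obtain ⟨hm, hp'⟩ := Finset.mem_product.1 hq'
      change l + p = m + q at heq
      have h₁ := floor_add_eq v (hTL l hl) (h.motif_subset hp)
      have h₂ := fract_add_eq v (hTL l hl) (h.motif_subset hp)
      rw [heq, floor_add_eq v (hTL m hm) (h.motif_subset hp')] at h₁
      rw [heq, fract_add_eq v (hTL m hm) (h.motif_subset hp')] at h₂
      exact Prod.ext h₁.symm h₂.symm
  have hvol : volume.real E ≤ T.card * volume.real (unitCell v) := by
    have hsub : E ⊆ ⋃ l ∈ T, {x | (ZSpan.floor v x : Space d) = l} := fun e he =>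
      Set.mem_iUnion₂.2 ⟨_, (Set.Finite.mem_toFinset _).2 ⟨e, he, rfl⟩, rfl⟩
    have hle : volume E ≤ T.card * volume (unitCell v) := by
      refine (measure_mono hsub).trans ((measure_biUnion_finset_le _ _).trans ?_)
      rw [Finset.sum_congr rfl fun l hl => volume_floor_eq v (hTL l hl), Finset.sum_const,
        nsmul_eq_mul]
    have hle' := ENNReal.toReal_mono
      (ENNReal.mul_ne_top (ENNReal.natCast_ne_top _) (isBounded_unitCell v).measure_lt_top.ne) hle
    rw [ENNReal.toReal_mul, ENNReal.toReal_natCast] at hle'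
    exact hle'
  calc (P.card : ℝ) * volume.real E
      ≤ P.card * (T.card * volume.real (unitCell v)) := by gcongr
    _ = (T.card * P.card : ℕ) * volume.real (unitCell v) := by push_cast; ring
    _ ≤ B.card * volume.real (unitCell v) := by gcongr

/-! ### The density does not depend on the representatives -/

theorem IsRepresentative.repDensity_le (h : IsRepresentative X v P)
    {w : Module.Basis (Fin d) ℝ (Space d)} {Q : Finset (Space d)}
    (h' : IsRepresentative X w Q) : repDensity v P ≤ repDensity w Q := by
  set a := diam (unitCell v)
  set b := diam (unitCell w)
  have ha : 0 ≤ a := diam_nonneg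
  have hb : 0 ≤ b := diam_nonneg
  have hU := volume_real_unitCell_pos v
  have hW := volume_real_unitCell_pos w
  set c := volume.real (closedBall (0 : Space d) 1)
  have hc : 0 < c :=
    ENNReal.toReal_pos (measure_closedBall_pos _ _ one_pos).ne' measure_closedBall_lt_top.ne
  have hball : ∀ r : ℝ, 0 ≤ r → volume.real (closedBall (0 : Space d) r) = r ^ d * c := by
    intro r hr
    rw [Measure.addHaar_real_closedBall' volume _ hr, finrank_euclideanSpace_fin]
  -- Both estimates are applied to the points of `X` in the ball of radius `r + a`.
  have key : ∀ r : ℝ, 0 < r → repDensity v P ≤ repDensity w Q * (1 + (a + b) * r⁻¹) ^ d := by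
    intro r hr
    have hfin := h.finite_inter (isBounded_closedBall (x := (0 : Space d)) (r := r + a))
    have h₁ := h.card_mul_volume_ge le_rfl (isBounded_closedBall (x := (0 : Space d)) (r := r))
      (B := hfin.toFinset) fun x hx e he hxe => by
        rw [Set.Finite.mem_toFinset]
        refine ⟨hx, mem_closedBall.2 ?_⟩
        linarith [dist_triangle x e 0, mem_closedBall.1 he]
    have h₂ := h'.card_mul_volume_le le_rfl (A := hfin.toFinset)
      (fun x hx => ((Set.Finite.mem_toFinset _).1 hx).1)
      (F := closedBall 0 (r + a + b)) measure_closedBall_lt_top.ne fun x hx => by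
        have hx' := mem_closedBall.1 ((Set.Finite.mem_toFinset _).1 hx).2
        exact closedBall_subset_closedBall' (by linarith)
    rw [hball r hr.le] at h₁
    rw [hball _ (by positivity)] at h₂
    have h₃ : (P.card : ℝ) / volume.real (unitCell v) * (r ^ d * c) ≤ hfin.toFinset.card := by
      rw [div_mul_eq_mul_div, div_le_iff₀ hU]
      exact h₁
    have h₄ : (hfin.toFinset.card : ℝ)
        ≤ (Q.card : ℝ) / volume.real (unitCell w) * ((r + a + b) ^ d * c) := by
      rw [div_mul_eq_mul_div, le_div_iff₀ hW]
      exact h₂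
    have hpow : (r + a + b) ^ d = (1 + (a + b) * r⁻¹) ^ d * r ^ d := by
      rw [← mul_pow]
      congr 1
      field_simp
      ring
    refine le_of_mul_le_mul_right ?_ (by positivity : 0 < r ^ d * c)
    calc _ ≤ _ := h₃.trans h₄
      _ = _ := by rw [hpow, repDensity]; ring
  have hlim : Filter.Tendsto (fun r : ℝ => repDensity w Q * (1 + (a + b) * r⁻¹) ^ d)
      Filter.atTop (nhds (repDensity w Q * (1 + (a + b) * 0) ^ d)) :=
    (((tendsto_inv_atTop_zero.const_mul (a + b)).const_add 1).pow d).const_mul _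
  rw [mul_zero, add_zero, one_pow, mul_one] at hlim
  exact ge_of_tendsto hlim (Filter.eventually_atTop.2 ⟨1, fun r hr => key r (by linarith)⟩)

theorem IsRepresentative.repDensity_eq (h : IsRepresentative X v P)
    {w : Module.Basis (Fin d) ℝ (Space d)} {Q : Finset (Space d)}
    (h' : IsRepresentative X w Q) : repDensity v P = repDensity w Q :=
  le_antisymm (h.repDensity_le h') (h'.repDensity_le h)

/-! ### Matching two periodic point sets of equal density -/

/-- Hall's theorem for the relation of lying within distance `2 * S`. -/
theorem exists_injective_dist_le {Y : Set (Space d)}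
    {w : Module.Basis (Fin d) ℝ (Space d)} {Q : Finset (Space d)}
    (hX : IsRepresentative X v P) (hY : IsRepresentative Y w Q)
    (hdens : repDensity v P = repDensity w Q) {S : ℝ}
    (hSX : diam (unitCell v) ≤ S) (hSY : diam (unitCell w) ≤ S) :
    ∃ f : X → Y, Function.Injective f ∧ ∀ x : X, dist (x : Space d) (f x) ≤ 2 * S := by
  classical
  have hfin : ∀ x : Space d, (Y ∩ closedBall x (2 * S)).Finite := fun x =>
    hY.finite_inter isBounded_closedBall
  obtain ⟨f, hf, hft⟩ := (Finset.all_card_le_biUnion_card_iff_exists_injective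
    fun x : X => (hfin x).toFinset).1 fun A => by
      set F : Set (Space d) := ⋃ a ∈ A, closedBall (a : Space d) S
      have hFb : Bornology.IsBounded F :=
        (Bornology.isBounded_biUnion_finset A).2 fun _ _ => isBounded_closedBall
      have h₁ := hX.card_mul_volume_le hSX (A := A.map (Function.Embedding.subtype _))
        (fun a ha => by
          obtain ⟨x, -, rfl⟩ := Finset.mem_map.1 ha
          exact x.2)
        (F := F) hFb.measure_lt_top.ne (fun a ha => by
          obtain ⟨x, hx, rfl⟩ := Finset.mem_map.1 ha
          exact Set.subset_biUnion_of_mem (u := fun x : X => closedBall (x : Space d) S) hx)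
      have h₂ := hY.card_mul_volume_ge hSY hFb
        (B := A.biUnion fun x : X => (hfin x).toFinset) fun y hy e he hye => by
          obtain ⟨x, hx, hex⟩ := Set.mem_iUnion₂.1 he
          refine Finset.mem_biUnion.2 ⟨x, hx, (Set.Finite.mem_toFinset _).2 ⟨hy, ?_⟩⟩
          rw [mem_closedBall] at hex ⊢
          linarith [dist_triangle y e x]
      rw [Finset.card_map] at h₁
      have hU := volume_real_unitCell_pos v
      have hW := volume_real_unitCell_pos w
      have h₃ := (le_div_iff₀ hU).2 h₁
      have h₄ := (div_le_iff₀ hW).2 h₂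
      rw [mul_div_right_comm] at h₃ h₄
      unfold repDensity at hdens
      rw [hdens] at h₃
      exact_mod_cast h₃.trans h₄
  have hmem : ∀ x : X, f x ∈ Y ∩ closedBall (x : Space d) (2 * S) := fun x =>
    (Set.Finite.mem_toFinset _).1 (hft x)
  refine ⟨fun x => ⟨f x, (hmem x).1⟩, fun x y hxy => hf (Subtype.ext_iff.1 hxy), fun x => ?_⟩
  rw [dist_comm]
  exact mem_closedBall.1 (hmem x).2

theorem bottleneckDist_le {Y : Set (Space d)}
    {w : Module.Basis (Fin d) ℝ (Space d)} {Q : Finset (Space d)}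
    (hX : IsRepresentative X v P) (hY : IsRepresentative Y w Q)
    (hdens : repDensity v P = repDensity w Q) {S : ℝ}
    (hSX : diam (unitCell v) ≤ S) (hSY : diam (unitCell w) ≤ S) :
    bottleneckDist X Y ≤ ENNReal.ofReal (2 * S) := by
  obtain ⟨f, hf, hfS⟩ := exists_injective_dist_le hX hY hdens hSX hSY
  obtain ⟨g, hg, hgS⟩ := exists_injective_dist_le hY hX hdens.symm hSY hSX
  obtain ⟨e, he, heS⟩ := Function.Embedding.schroeder_bernstein_of_rel hf hg
    (fun x y => dist (x : Space d) y ≤ 2 * S) hfS fun y => by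
      rw [dist_comm]
      exact hgS y
  refine iInf_le_of_le (Equiv.ofBijective e he) (iSup_le fun x => ?_)
  rw [edist_dist]
  exact ENNReal.ofReal_le_ofReal (heS x)

end Counting

end PeriodicPointSet

theorem mainTheorem4 (d : ℕ) (κ S : ℝ) (hS : 0 < S) :
    ∃ K : ℝ, 0 < K ∧
      ∀ X₁ ∈ PeriodicPointSet.PPSOfDensity d κ, ∀ X₂ ∈ PeriodicPointSet.PPSOfDensity d κ,
        (∃ v₁ P₁, PeriodicPointSet.IsRepresentative X₁ v₁ P₁ ∧
          Metric.diam (PeriodicPointSet.unitCell v₁) ≤ S) →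
        (∃ v₂ P₂, PeriodicPointSet.IsRepresentative X₂ v₂ P₂ ∧
          Metric.diam (PeriodicPointSet.unitCell v₂) ≤ S) →
        PeriodicPointSet.euclideanBottleneckDist X₁ X₂ ≤ ENNReal.ofReal K := by
  refine ⟨2 * S, by positivity, ?_⟩
  rintro X₁ ⟨w₁, Q₁, hw₁, hκ₁⟩ X₂ ⟨w₂, Q₂, hw₂, hκ₂⟩ ⟨v₁, P₁, h₁, hS₁⟩ ⟨v₂, P₂, h₂, hS₂⟩
  have hdens : PeriodicPointSet.repDensity v₁ P₁ = PeriodicPointSet.repDensity v₂ P₂ := by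
    rw [h₁.repDensity_eq hw₁, hκ₁, h₂.repDensity_eq hw₂, hκ₂]
  refine iInf_le_of_le (IsometryEquiv.refl _) ?_
  rw [show ⇑(IsometryEquiv.refl (PeriodicPointSet.Space d)) = id from rfl, Set.image_id]
  exact PeriodicPointSet.bottleneckDist_le h₁ h₂ hdens hS₁ hS₂
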